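/- Let $\pi$ be a (discrete) group and $G=\pi\times\pi$. Let $\mathcal D$ be the smallest family of subgroups of $G$ that contains the trivial subgroup and the diagonal and is closed under conjugation and finite intersections, and let $\mathcal O_{\mathcal D}$ be the category of orbits $G/H$, $H\in\mathcal D$, with $G$-equivariant maps. An $\mathcal O_{\mathcal D}$-module is a contravariant functor $\underline M$ from $\mathcal O_{\mathcal D}$ to abelian groups; its *principal component* is the left $\mathbb Z[G]$-module $\underline M(G/1)$, on which $a\in G$ acts through the right translation $g\mapsto ga$ of $G/1$. The module $\underline M$ is *principal* if for every $H\in\mathcal D$ the projection $G/1\to G/H$ induces an isomorphism of $\underline M(G/H)$ onto the group of $H$-invariants $\underline M(G/1)^H$. View $\pi$ as a left $G$-set by $(x,y)\cdot g=xgy^{-1}$, and let $E(\pi)$ be the $G$-CW-complex with $k$-cells the sequences $(g_0,\dots,g_k)\in\pi^{k+1}$; it is a model of the classifying space $E_{\mathcal D}(G)$. The Bredon cohomology $H^n_{\mathcal D}(\pi\times\pi;\underline M)$ is the cohomology of the complex of $\mathcal O_{\mathcal D}$-morphisms from the cellular chains $G/H\mapsto C_*(E(\pi)^H)$ to $\underline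 M$. If $A$ is the principal component of $\underline M$, let $$\Phi:H^n_{\mathcal D}(\pi\times\pi;\underline M)\to H^n(\pi\times\pi;A)$$ be the homomorphism obtained by restricting to principal components and pulling back along the equivariant map $E(\pi\times\pi)\to E(\pi)$ induced by $(x,y)\mapsto xy^{-1}$. Let $I=\ker(\mathbb Z[\pi]\to\mathbb Z)$ be the augmentation ideal with its left $G$-action, let $I^n=I\otimes_{\mathbb Z}\dots\otimes_{\mathbb Z}I$ with the diagonal action ($I^0=\mathbb Z$), let $\mathfrak v\in H^1(\pi\times\pi;I)$ be the canonical class, represented by the cocycle $(x,y)\mapsto xy^{-1}-1$, and let $\mathfrak v^n\in H^n(\pi\times\pi;I^n)$ be its $n$-fold cup power ($\mathfrak v^0=1$). A class $\beta\in H^n(\pi\times\pi;A)$ is *essential* if $\beta=\mu_*(\mathfrak v^n)$ for some homomorphism of $\mathbb Z[G]$-modules $\mu:I^n\to A$. The group $\pi$ is *principal* if for all finite subsets $S,S'\subset\pi$ the index of the centraliser $Z(S\cup S')$ in $Z(S)$ is either $1$ or infinite. **Theorem.** Let $n\ge 0$. (1) For every $\mathcal O_{\mathcal D}$-module $\underline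 M$ with principal component $A$, every class in the image of $\Phi:H^n_{\mathcal D}(\pi\times\pi;\underline M)\to H^n(\pi\times\pi;A)$ is essential. (2) Suppose that the group $\pi$ is principal. If $\underline M$ is a principal $\mathcal O_{\mathcal D}$-module with principal component $A$ (that is, $\underline M(G/H)\cong A^H$), then the set of essential classes in $H^n(\pi\times\pi;A)$ is exactly the image of $\Phi$. Moreover, for every left $\mathbb Z[G]$-module $A$, a class $\beta\in H^n(\pi\times\pi;A)$ is essential if and only if it is the image under $\Phi$ of a Bredon cohomology class with coefficients in some $\mathcal O_{\mathcal D}$-module whose principal component is (isomorphic to) $A$. -/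

import Mathlib

open CategoryTheory Opposite TensorProduct

noncomputable section

namespace Bredon

/-! ### The group `π × π`, the `π × π`-set `π` and the family `D` -/

/-- The set `π`, regarded as a left `π × π`-set through `(x, y) • g = x g y⁻¹`. -/
def TwoSided (π : Type) : Type := π

section Basic

variable (π : Type) [Group π]

instance : MulAction (π × π) (TwoSided π) where
  smul p g := (p.1 * (show π from g) * p.2⁻¹ : π)
  one_smul g := by
    have h (x : π) : (1 : π) * x * (1 : π)⁻¹ = x := by simp
    exact h g
  mul_smul p q g := by
    have h (x : π) : (p.1 * q.1) * x * (p.2 * q.2)⁻¹ = p.1 * (q.1 * x * q.2⁻¹) * p.2⁻¹ := by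
      simp [mul_assoc]
    exact h g

/-- The diagonal subgroup of `π × π`. -/
def diagonal : Subgroup (π × π) := ((MonoidHom.id π).prod (MonoidHom.id π)).range

/-- The family `D`: the smallest family of subgroups of `π × π` which contains the trivial
subgroup and the diagonal and is closed under conjugation and finite intersections. -/
inductive InFamily : Subgroup (π × π) → Prop
  | bot : InFamily ⊥
  | diagonal : InFamily (diagonal π)
  | conj {H : Subgroup (π × π)} (g : π × π) :
      InFamily H → InFamily (H.map (MulAut.conj g).toMonoidHom)
  | inf {H K : Subgroup (π × π)} : InFamily H → InFamily K → InFamily (H ⊓ K)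

/-- A group is principal if, for all finite subsets `S`, `S'`, the index of `Z(S ∪ S')` in `Z(S)`
is either `1` or infinite (`relIndex` takes the value `0` if the index is infinite). -/
def IsPrincipalGroup : Prop :=
  ∀ S S' : Finset π,
    (Subgroup.centralizer ((S : Set π) ∪ (S' : Set π))).relIndex
        (Subgroup.centralizer (S : Set π)) = 1 ∨
      (Subgroup.centralizer ((S : Set π) ∪ (S' : Set π))).relIndex
        (Subgroup.centralizer (S : Set π)) = 0

/-! ### The orbit category and its modules -/

/-- The objects `(π × π) / H`, `H ∈ D`, of the orbit category. -/
structure Orbit where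
  /-- the isotropy subgroup of the base point -/
  H : Subgroup (π × π)
  mem : InFamily π H

/-- The morphisms of the orbit category are the equivariant maps of orbits. -/
instance : Category (Orbit π) where
  Hom X Y := ((π × π) ⧸ X.H) →[π × π] ((π × π) ⧸ Y.H)
  id X := MulActionHom.id (π × π)
  comp f g := g.comp f

/-- Right modules over the orbit category with values in `k`-modules. For `k = ℤ` these are the
contravariant functors from the orbit category to abelian groups. -/
abbrev OModule (k : Type) [CommRing k] := (Orbit π)ᵒᵖ ⥤ ModuleCat.{0} k

/-- The free orbit `(π × π) / 1`. -/
def freeOrbit : Orbit π := ⟨⊥, .bot⟩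

end Basic

variable {k : Type} [CommRing k] {π : Type} [Group π]

/-- The equivariant map `(π × π) / 1 → X` with `g ↦ g • x`. -/
def ofPoint {X : Type} [MulAction (π × π) X] (x : X) :
    ((π × π) ⧸ (freeOrbit π).H) →[π × π] X where
  toFun q := Quotient.liftOn' q (fun g => g • x) (by
    intro a b h
    have h' : a⁻¹ * b = 1 := by
      rw [QuotientGroup.leftRel_apply] at h
      exact Subgroup.mem_bot.1 h
    rw [inv_mul_eq_one.1 h'])
  map_smul' g q := by
    induction q using Quotient.inductionOn' with
    | h a => exact mul_smul g a x

@[simp]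
lemma ofPoint_mk {X : Type} [MulAction (π × π) X] (x : X) (g : π × π) :
    ofPoint x (QuotientGroup.mk g : (π × π) ⧸ (freeOrbit π).H) = g • x := rfl

lemma free_hom_ext {X : Type} [MulAction (π × π) X]
    {f f' : ((π × π) ⧸ (freeOrbit π).H) →[π × π] X}
    (h : f (QuotientGroup.mk 1) = f' (QuotientGroup.mk 1)) : f = f' := by
  ext q
  induction q using QuotientGroup.induction_on with
  | H g =>
    have e : (QuotientGroup.mk g : (π × π) ⧸ (freeOrbit π).H)
        = g • (QuotientGroup.mk 1 : (π × π) ⧸ (freeOrbit π).H) := by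
      change _ = QuotientGroup.mk (g * 1)
      rw [mul_one]
    rw [e, map_smul, map_smul, h]

/-- The map of orbits `(π × π) / 1 → (π × π) / K`, `g ↦ g a K`. -/
def translate (K : Orbit π) (a : π × π) : freeOrbit π ⟶ K :=
  ofPoint (QuotientGroup.mk a : (π × π) ⧸ K.H)

/-- The principal component `M((π × π) / 1)` of `M`; a group element `a` acts through
the right translation `g ↦ g a` of `(π × π) / 1`. -/
def principalComponent (M : OModule π k) : Rep.{0} k (π × π) :=
  Rep.of (X := M.obj (op (freeOrbit π)))
    { toFun := fun a => (M.map (translate (freeOrbit π) a).op).hom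
      map_one' := by
        have h : translate (freeOrbit π) (1 : π × π) = 𝟙 _ :=
          free_hom_ext (one_smul _ _)
        rw [h]
        simp
        rfl
      map_mul' := fun a b => by
        have h : translate (freeOrbit π) (a * b)
            = translate (freeOrbit π) a ≫ translate (freeOrbit π) b := by
          refine free_hom_ext ?_
          change (1 : π × π) • (QuotientGroup.mk (a * b) : (π × π) ⧸ (freeOrbit π).H)
            = ofPoint (QuotientGroup.mk b : (π × π) ⧸ (freeOrbit π).H)
                ((1 : π × π) • QuotientGroup.mk a)
          rw [one_smul, one_smul]
          rfl
        rw [h, op_comp, M.map_comp]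
        rfl }

/-- `M` is principal if for every `H ∈ D` the map `M((π × π) / H) → M((π × π) / 1)` induced by the
projection is a bijection onto the `H`-invariants of the principal component. -/
def IsPrincipalModule (M : OModule π k) : Prop :=
  ∀ K : Orbit π, Set.BijOn
    (fun m : M.obj (op K) => (M.map (translate K 1).op).hom m)
    Set.univ
    {a | ∀ h ∈ K.H, (principalComponent M).ρ h a = a}

/-! ### Bredon cohomology -/

/-- The contravariant functor `[?, X]` on the orbit category, for a `π × π`-set `X`. -/
def homSet (X : Type) [MulAction (π × π) X] : (Orbit π)ᵒᵖ ⥤ Type where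
  obj K := ((π × π) ⧸ K.unop.H) →[π × π] X
  map f := ↾fun x => x.comp f.unop
  map_id _ := rfl
  map_comp _ _ := rfl

/-- The natural map `[?, X] → [?, Y]` induced by an equivariant map `X → Y`. -/
def homSetMap {X Y : Type} [MulAction (π × π) X] [MulAction (π × π) Y]
    (φ : X →[π × π] Y) : (homSet X : (Orbit π)ᵒᵖ ⥤ Type) ⟶ homSet Y where
  app K := ↾fun (x : ((π × π) ⧸ K.unop.H) →[π × π] X) => φ.comp x
  naturality _ _ _ := rfl

/-- The free module `k[?, X]`. -/
def freeModule (X : Type) [MulAction (π × π) X] : OModule π k :=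
  homSet X ⋙ ModuleCat.free k

/-- The map `k[?, X] → k[?, Y]` induced by an equivariant map `X → Y`. -/
def freeModuleMap {X Y : Type} [MulAction (π × π) X] [MulAction (π × π) Y]
    (φ : X →[π × π] Y) : (freeModule X : OModule π k) ⟶ freeModule Y :=
  Functor.whiskerRight (homSetMap φ) (ModuleCat.free k)

lemma freeModuleMap_id (X : Type) [MulAction (π × π) X] :
    (freeModuleMap (MulActionHom.id (π × π)) : (freeModule X : OModule π k) ⟶ _) = 𝟙 _ := by
  refine NatTrans.ext (funext fun K => ?_)
  exact (ModuleCat.free k).map_id ((homSet X).obj K)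

lemma freeModuleMap_comp {X Y Z : Type} [MulAction (π × π) X] [MulAction (π × π) Y]
    [MulAction (π × π) Z] (φ : X →[π × π] Y) (ψ : Y →[π × π] Z) :
    (freeModuleMap (ψ.comp φ) : (freeModule X : OModule π k) ⟶ _)
      = freeModuleMap φ ≫ freeModuleMap ψ := by
  refine NatTrans.ext (funext fun K => ?_)
  exact (ModuleCat.free k).map_comp ((homSetMap φ).app K) ((homSetMap ψ).app K)

/-- Pulling back tuples of elements of a `π × π`-set along a map of index sets. -/
def reindex (X : Type) [MulAction (π × π) X] {ι κ : Type} (θ : ι → κ) :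
    (κ → X) →[π × π] (ι → X) where
  toFun x := x ∘ θ
  map_smul' _ _ := rfl

variable (k π) in
/-- The simplicial module with `m`-simplices `k[?, π ^ (m + 1)]`. -/
def simplicialModule : SimplicialObject (OModule π k) where
  obj m := freeModule (Fin (m.unop.len + 1) → TwoSided π)
  map θ := freeModuleMap (reindex (TwoSided π) θ.unop.toOrderHom)
  map_id m := by
    have h : reindex (TwoSided π) (ι := Fin (m.unop.len + 1)) ((𝟙 m : m ⟶ m).unop.toOrderHom)
        = MulActionHom.id (π × π) := rfl
    rw [h]
    exact freeModuleMap_id (Fin (m.unop.len + 1) → TwoSided π)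
  map_comp θ η := by
    rw [← freeModuleMap_comp]
    rfl

variable (k π) in
/-- The module of `n`-chains `k[?, π ^ (n + 1)]`. -/
def chainModule (n : ℕ) : OModule π k := freeModule (Fin (n + 1) → TwoSided π)

variable (k π) in
/-- The boundary `(g₀, …, g_{n+1}) ↦ ∑ (-1)^j (g₀, …, ĝ_j, …, g_{n+1})`. -/
def boundary (n : ℕ) : chainModule k π (n + 1) ⟶ chainModule k π n :=
  ∑ j : Fin (n + 2), (-1 : ℤ) ^ (j : ℕ) • freeModuleMap (reindex (TwoSided π) j.succAbove)

lemma boundary_comp (n : ℕ) : boundary k π (n + 1) ≫ boundary k π n = 0 :=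
  AlgebraicTopology.AlternatingFaceMapComplex.d_squared (simplicialModule k π) n

variable (k π) in
/-- The chain complex of modules over the orbit category whose value at `(π × π) / H` is the
cellular chain complex of the fixed point set `E(π)^H`. Here `E(π)` is the `π × π`-CW-complex
whose `n`-cells are the sequences `(g₀, …, g_n)` of elements of `π`, glued along the faces obtained
by omitting an entry; it is a model of the classifying space `E_D(π × π)`. -/
def chains : ChainComplex (OModule π k) ℕ :=
  ChainComplex.of (chainModule k π) (boundary k π) boundary_comp

/-- The coboundary, composition with the boundary of the chain complex. -/
def coboundary (M : OModule π k) (n : ℕ) :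
    ModuleCat.of k (chainModule k π n ⟶ M) ⟶ ModuleCat.of k (chainModule k π (n + 1) ⟶ M) :=
  ModuleCat.ofHom (Linear.leftComp k M (boundary k π n))

/-- The cochain complex of homomorphisms from the chains of `E(π)` to `M`. -/
def cochains (M : OModule π k) : CochainComplex (ModuleCat.{0} k) ℕ :=
  CochainComplex.of (fun n => ModuleCat.of k (chainModule k π n ⟶ M)) (coboundary M) fun n => by
    refine ModuleCat.hom_ext (LinearMap.ext fun f => ?_)
    change boundary k π (n + 1) ≫ boundary k π n ≫ f = 0
    rw [← Category.assoc, boundary_comp, Limits.zero_comp]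

lemma cochains_d (M : OModule π k) (n : ℕ) : (cochains M).d n (n + 1) = coboundary M n :=
  CochainComplex.of_d _ (coboundary M) n

/-- Bredon cohomology `H^n_D(π × π; M)`. -/
def cohomology (M : OModule π k) (n : ℕ) : ModuleCat.{0} k :=
  (cochains M).homology n

/-! ### The homomorphism to group cohomology -/

/-- The map `π × π → π`, `(x, y) ↦ x y⁻¹`. -/
def quotientMap (p : π × π) : TwoSided π := (p.1 * p.2⁻¹ : π)

lemma quotientMap_mul (p q : π × π) : quotientMap (p * q) = p • quotientMap q := by
  change ((p.1 * q.1) * (p.2 * q.2)⁻¹ : π) = (p.1 * (q.1 * q.2⁻¹) * p.2⁻¹ : π)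
  simp [mul_assoc]

/-- The image `(F(1), F(a₁), F(a₁ a₂), …, F(a₁ ⋯ a_n))` under `F(x, y) = x y⁻¹` of the simplex
`(1, a₁, a₁ a₂, …, a₁ ⋯ a_n)` of `E(π × π)`. -/
def simplex {n : ℕ} (a : Fin n → π × π) : Fin (n + 1) → TwoSided π :=
  fun i => quotientMap (Fin.partialProd a i)

/-- The generator of `k[(π × π) / 1, X] = k[X]` belonging to a point of `X`. -/
def generator {X : Type} [MulAction (π × π) X] (x : X) :
    (freeModule X : OModule π k).obj (op (freeOrbit π)) :=
  ModuleCat.freeMk (ofPoint x : ((π × π) ⧸ (freeOrbit π).H) →[π × π] X)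

lemma freeModuleMap_generator {X Y : Type} [MulAction (π × π) X] [MulAction (π × π) Y]
    (φ : X →[π × π] Y) (x : X) :
    ((freeModuleMap φ : (freeModule X : OModule π k) ⟶ _).app (op (freeOrbit π))).hom
      (generator x) = generator (φ x) := by
  refine (ModuleCat.free_map_apply ((homSetMap φ).app (op (freeOrbit π)))
    (ofPoint x : ((π × π) ⧸ (freeOrbit π).H) →[π × π] X)).trans ?_
  refine congrArg ModuleCat.freeMk (free_hom_ext ?_)
  change φ ((1 : π × π) • x) = (1 : π × π) • φ x
  rw [map_smul]

lemma map_translate_generator {X : Type} [MulAction (π × π) X] (a : π × π) (x : X) :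
    ((freeModule X : OModule π k).map (translate (freeOrbit π) a).op).hom (generator x)
      = generator (a • x) := by
  refine (ModuleCat.free_map_apply ((homSet X).map (translate (freeOrbit π) a).op)
    (ofPoint x : ((π × π) ⧸ (freeOrbit π).H) →[π × π] X)).trans ?_
  refine congrArg ModuleCat.freeMk (free_hom_ext ?_)
  change ofPoint x ((1 : π × π) • (QuotientGroup.mk a : (π × π) ⧸ (freeOrbit π).H))
    = (1 : π × π) • a • x
  rw [one_smul, one_smul]
  rfl

/-- The value of a natural transformation on a generator. -/
def value {X : Type} [MulAction (π × π) X] {M : OModule π k} (f : freeModule X ⟶ M) (x : X) :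
    principalComponent M :=
  (f.app (op (freeOrbit π))).hom (generator x)

lemma rho_value {X : Type} [MulAction (π × π) X] {M : OModule π k} (f : freeModule X ⟶ M)
    (a : π × π) (x : X) : (principalComponent M).ρ a (value f x) = value f (a • x) := by
  have h := congrArg (fun t => t.hom (generator x)) (f.naturality (translate (freeOrbit π) a).op)
  refine Eq.trans h.symm ?_
  change (f.app (op (freeOrbit π))).hom (((freeModule X : OModule π k).map _).hom _) = _
  rw [map_translate_generator]
  rfl

lemma value_freeModuleMap {X Y : Type} [MulAction (π × π) X] [MulAction (π × π) Y]
    {M : OModule π k} (φ : X →[π × π] Y) (f : freeModule Y ⟶ M) (x : X) :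
    value (freeModuleMap φ ≫ f) x = value f (φ x) :=
  congrArg (f.app (op (freeOrbit π))).hom (freeModuleMap_generator φ x)

/-- Evaluation at a generator is additive. -/
def valueHom {X : Type} [MulAction (π × π) X] (M : OModule π k) (x : X) :
    (freeModule X ⟶ M) →+ principalComponent M where
  toFun g := value g x
  map_zero' := rfl
  map_add' _ _ := rfl

lemma value_boundary {M : OModule π k} {n : ℕ} (f : freeModule (Fin (n + 1) → TwoSided π) ⟶ M)
    (x : Fin (n + 2) → TwoSided π) :
    value (X := Fin (n + 2) → TwoSided π) (boundary k π n ≫ f) x =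
      ∑ j : Fin (n + 2), (-1 : k) ^ (j : ℕ) • value f (x ∘ j.succAbove) := by
  have h : boundary k π n ≫ f = ∑ j : Fin (n + 2),
      (-1 : ℤ) ^ (j : ℕ) • (freeModuleMap (reindex (TwoSided π) j.succAbove) ≫ f) := by
    refine (Preadditive.sum_comp _ _ _).trans (Finset.sum_congr rfl fun j _ => ?_)
    exact Preadditive.zsmul_comp _ _ _
  refine (congrArg (valueHom M x) h).trans ?_
  rw [map_sum]
  refine Finset.sum_congr rfl fun j _ => ?_
  rw [map_zsmul]
  change _ • value (freeModuleMap (reindex (TwoSided π) j.succAbove) ≫ f) x = _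
  rw [value_freeModuleMap]
  rcases Nat.even_or_odd (j : ℕ) with h' | h' <;> simp [h'.neg_one_pow] <;> rfl

lemma smul_simplex_succ {n : ℕ} (a : Fin (n + 1) → π × π) :
    a 0 • simplex (fun i => a i.succ) = simplex a ∘ Fin.succ := by
  funext i
  simp only [Function.comp_apply, simplex, Fin.partialProd_succ', quotientMap_mul]
  rfl

lemma simplex_contractNth {n : ℕ} (a : Fin (n + 1) → π × π) (j : Fin (n + 1)) :
    simplex (Fin.contractNth j (· * ·) a) = simplex a ∘ j.succ.succAbove := by
  funext i
  simp only [Function.comp_apply, simplex, Fin.partialProd_contractNth]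

lemma phi_comm (M : OModule π k) (n : ℕ) (f : freeModule (Fin (n + 1) → TwoSided π) ⟶ M)
    (a : Fin (n + 1) → π × π) :
    (principalComponent M).ρ (a 0) (value f (simplex fun i => a i.succ)) +
      ∑ j : Fin (n + 1), (-1 : k) ^ ((j : ℕ) + 1) •
        value f (simplex (Fin.contractNth j (· * ·) a)) =
    value (X := Fin (n + 2) → TwoSided π) (boundary k π n ≫ f) (simplex a) := by
  rw [value_boundary, Fin.sum_univ_succ (n := n + 1), rho_value, smul_simplex_succ]
  simp only [simplex_contractNth, Fin.val_zero, pow_zero, one_smul, Fin.val_succ,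
    Fin.succAbove_zero]

/-- On cochains: evaluate the principal component of a cochain on the images in `E(π)` of the
simplices of `E(π × π)`, in inhomogeneous coordinates. -/
def phiCochains (M : OModule π k) :
    cochains M ⟶ groupCohomology.inhomogeneousCochains (principalComponent M) where
  f n := ModuleCat.ofHom
    (X := chainModule k π n ⟶ M) (Y := (Fin n → π × π) → principalComponent M)
    { toFun := fun f a => value (X := Fin (n + 1) → TwoSided π) f (simplex a)
      map_add' := fun _ _ => rfl
      map_smul' := fun _ _ => rfl }
  comm' i j h := by
    obtain rfl : i + 1 = j := h
    rw [groupCohomology.inhomogeneousCochains.d_def, cochains_d]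
    refine ModuleCat.hom_ext (LinearMap.ext fun f => funext fun a => ?_)
    exact phi_comm M i f a

/-- The natural homomorphism `Φ : H^n_D(π × π; M) → H^n(π × π; A)`, `A` the principal component of
`M`, induced by the equivariant map `F : E(π × π) → E(π)`. -/
def phi (M : OModule π k) (n : ℕ) :
    cohomology M n ⟶ groupCohomology (principalComponent M) n :=
  HomologicalComplex.homologyMap (phiCochains M) n

/-! ### The canonical class, its powers and essential classes -/

variable (k π) in
/-- The representation of `π × π` on the free module `k[π]`. -/
def regular : Representation k (π × π) (TwoSided π →₀ k) where
  toFun a := Finsupp.lmapDomain k k (fun g => a • g)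
  map_one' := by
    ext
    simp
  map_mul' a b := by
    ext
    simp [mul_smul]

variable (k π) in
/-- The augmentation `k[π] → k`. -/
def augmentation : (TwoSided π →₀ k) →ₗ[k] k := Finsupp.linearCombination k (fun _ => (1 : k))

lemma augmentation_regular (a : π × π) (x : TwoSided π →₀ k) :
    augmentation k π (regular k π a x) = augmentation k π x := by
  simp [augmentation, regular, Finsupp.linearCombination_mapDomain, Function.comp_def]

variable (k π) in
/-- The augmentation ideal `I`, the kernel of the augmentation, with its action of `π × π`. -/
def augIdeal : Rep.{0} k (π × π) :=
  Rep.of (X := LinearMap.ker (augmentation k π))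
    { toFun := fun a => (regular k π a).restrict fun x hx => by
        rw [LinearMap.mem_ker] at hx ⊢
        rw [augmentation_regular, hx]
      map_one' := by
        ext x
        simp
      map_mul' := fun a b => by
        ext x
        simp }

variable (k π) in
/-- The tensor powers `I^n` over `k` with the diagonal action of `π × π`; `I^0 = k`. -/
def idealPow : ℕ → Rep.{0} k (π × π)
  | 0 => Rep.trivial k (π × π) k
  | n + 1 => MonoidalCategory.tensorObj (augIdeal k π) (idealPow n)

/-- The cocycle `(x, y) ↦ x y⁻¹ - 1` of the canonical class, i.e. of the class of the extension
`0 → I → k[π] → k → 0`. -/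
def canonicalCochain (a : π × π) : augIdeal k π :=
  (⟨Finsupp.single (quotientMap a) 1 - Finsupp.single (quotientMap 1) 1, by
    simp [augmentation]⟩ : LinearMap.ker (augmentation k π))

/-- The cup product of a `1`-cochain `v` and an `n`-cochain `w`:
`(v ∪ w)(a₀, …, a_n) = v(a₀) ⊗ a₀ • w(a₁, …, a_n)`. -/
def cup {A B : Rep.{0} k (π × π)} {n : ℕ} (v : π × π → A) (w : (Fin n → π × π) → B)
    (a : Fin (n + 1) → π × π) : (MonoidalCategory.tensorObj A B : Rep.{0} k (π × π)) :=
  (v (a 0) ⊗ₜ[k] B.ρ (a 0) (w (Fin.tail a)) : A ⊗[k] B)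

/-- The `n`-fold cup product of the cocycle of the canonical class with itself. -/
def canonicalPowCochain : (n : ℕ) → (Fin n → π × π) → idealPow k π n
  | 0 => fun _ => (1 : k)
  | n + 1 => cup canonicalCochain (canonicalPowCochain n)

lemma canonicalCochain_mul (a b : π × π) :
    (canonicalCochain (a * b) : augIdeal k π) = canonicalCochain a + (augIdeal k π).ρ a (canonicalCochain b) := by
  refine Subtype.ext ?_
  change _ = (Finsupp.single (quotientMap a) 1 - Finsupp.single (quotientMap 1) 1) +
    regular k π a (Finsupp.single (quotientMap b) 1 - Finsupp.single (quotientMap 1) 1)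
  have h : a • (quotientMap 1 : TwoSided π) = quotientMap a := by
    rw [← quotientMap_mul, mul_one]
  rw [map_sub]
  simp [regular, Finsupp.mapDomain_single, ← quotientMap_mul, canonicalCochain]

lemma d_cup {A B : Rep.{0} k (π × π)} (v : π × π → A)
    (hv : ∀ a b, v (a * b) = v a + A.ρ a (v b)) {n : ℕ} (w : (Fin n → π × π) → B)
    (hw : (inhomogeneousCochains.d B n).hom w = 0) :
    (inhomogeneousCochains.d (MonoidalCategory.tensorObj A B) (n + 1)).hom (cup v w) = 0 := by
  funext a
  have h := congrFun hw (Fin.tail a)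
  rw [inhomogeneousCochains.d_hom_apply] at h ⊢
  replace h := h.trans (Pi.zero_apply (M := fun _ => B) (Fin.tail a))
  rw [Fin.sum_univ_succ]
  have h0 : cup v w (Fin.contractNth 0 (· * ·) a) =
      (v (a 0) ⊗ₜ[k] B.ρ (a 0) (B.ρ (a 1) (w fun i => Fin.tail a i.succ)) +
        A.ρ (a 0) (v (a 1)) ⊗ₜ[k] B.ρ (a 0) (B.ρ (a 1) (w fun i => Fin.tail a i.succ)) :
          A ⊗[k] B) := by
    have e1 : Fin.contractNth 0 (· * ·) a 0 = a 0 * a 1 := rfl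
    have e2 : Fin.tail (Fin.contractNth 0 (· * ·) a) = fun i => Fin.tail a i.succ := rfl
    change (v (Fin.contractNth 0 (· * ·) a 0) ⊗ₜ[k] B.ρ (Fin.contractNth 0 (· * ·) a 0)
      (w (Fin.tail (Fin.contractNth 0 (· * ·) a))) : A ⊗[k] B) = _
    rw [e1, e2, hv, map_mul, TensorProduct.add_tmul]
    rfl
  have h1 (j : Fin (n + 1)) : cup v w (Fin.contractNth j.succ (· * ·) a) =
      (v (a 0) ⊗ₜ[k] B.ρ (a 0) (w (Fin.contractNth j (· * ·) (Fin.tail a))) : A ⊗[k] B) := by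
    have e1 : Fin.contractNth j.succ (· * ·) a 0 = a 0 := rfl
    have e2 : Fin.tail (Fin.contractNth j.succ (· * ·) a)
        = Fin.contractNth j (· * ·) (Fin.tail a) := by
      funext i
      simp only [Fin.tail, Fin.contractNth, Fin.val_succ, Nat.add_lt_add_iff_right,
        Nat.add_right_cancel_iff]
      rfl
    change (v (Fin.contractNth j.succ (· * ·) a 0) ⊗ₜ[k] B.ρ (Fin.contractNth j.succ (· * ·) a 0)
      (w (Fin.tail (Fin.contractNth j.succ (· * ·) a))) : A ⊗[k] B) = _
    rw [e1, e2]
  have h2 : (MonoidalCategory.tensorObj A B).ρ (a 0) (cup v w fun i => a i.succ) =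
      (A.ρ (a 0) (v (a 1)) ⊗ₜ[k] B.ρ (a 0) (B.ρ (a 1) (w fun i => Fin.tail a i.succ)) :
          A ⊗[k] B) := rfl
  have h3 := congrArg (fun b => (v (a 0) ⊗ₜ[k] B.ρ (a 0) b : A ⊗[k] B)) h
  rw [h0, h2]
  simp only [h1]
  simp only [map_add, map_sum, map_smul, TensorProduct.tmul_add, TensorProduct.tmul_sum,
    TensorProduct.tmul_smul, map_zero, TensorProduct.tmul_zero] at h3
  change (_ : A ⊗[k] B) = 0
  have h4 : ∑ j : Fin (n + 1), (-1 : k) ^ ((j.succ : ℕ) + 1) •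
      (v (a 0) ⊗ₜ[k] B.ρ (a 0) (w (Fin.contractNth j (· * ·) (Fin.tail a))) : A ⊗[k] B) =
      v (a 0) ⊗ₜ[k] B.ρ (a 0) (B.ρ (a 1) (w fun i => Fin.tail a i.succ)) := by
    refine (sub_eq_zero.1 (Eq.trans ?_ h3)).symm
    rw [sub_eq_add_neg, ← Finset.sum_neg_distrib]
    refine congrArg₂ _ rfl (Finset.sum_congr rfl fun j _ => ?_)
    rw [Fin.val_succ, pow_succ (-1 : k) ((j : ℕ) + 1), mul_neg_one, neg_smul, neg_neg]
  refine (congrArg₂ (· + ·) rfl (congrArg₂ (· + ·) rfl h4)).trans ?_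
  simp only [Fin.val_zero, zero_add, pow_one, neg_smul, one_smul]
  abel

lemma d_canonicalPowCochain (n : ℕ) :
    (inhomogeneousCochains.d (idealPow k π n) n).hom (canonicalPowCochain n) = 0 := by
  induction n with
  | zero =>
    funext a
    rw [inhomogeneousCochains.d_hom_apply]
    exact (by simp : (1 : k) + ∑ j : Fin 1, (-1 : k) ^ ((j : ℕ) + 1) • (1 : k) = 0)
  | succ n ih =>
    exact d_cup canonicalCochain canonicalCochain_mul (canonicalPowCochain n) ih

variable (k π) in
/-- The power `v^n ∈ H^n(π × π; I^n)` of the canonical class. -/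
def canonicalPow (n : ℕ) : groupCohomology (idealPow k π n) n :=
  groupCohomology.π (idealPow k π n) n
    (groupCohomology.cocyclesMk (canonicalPowCochain n) (d_canonicalPowCochain n))

/-- The map `μ_* : H^n(π × π; A) → H^n(π × π; B)` induced by a homomorphism `μ : A → B`. -/
def coeffMap {A B : Rep.{0} k (π × π)} (μ : A ⟶ B) (n : ℕ) :
    groupCohomology A n ⟶ groupCohomology B n :=
  (groupCohomology.functor k (π × π) n).map μ

/-- A class is essential if it is of the form `μ_*(v^n)` for a homomorphism `μ : I^n → A`. -/
def IsEssential {A : Rep.{0} k (π × π)} {n : ℕ} (β : groupCohomology A n) : Prop :=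
  ∃ μ : idealPow k π n ⟶ A, (coeffMap μ n).hom (canonicalPow k π n) = β

end Bredon

end

/-! Everything is computed with homogeneous chains. The free module on `π ^ n` is the term of degree
`n - 1` of the augmented complex of `E(π)`, with the empty tuple spanning the augmentation term.
Coning with a vertex `g` contracts this complex, and multiplying out tensors embeds `I^n`
equivariantly into the cycles among the `n`-tuples (`face_idealPowToTuples`).

Image of `Φ` is essential: at the free orbit a Bredon cocycle is an equivariant function `f` on `(n
+ 1)`-tuples that kills boundaries. Put `μ(x) = f(1 ⊗ x)`; moving the apex `1` changes the chain by
a boundary, so `μ` is equivariant (`ofCocycle`). On the simplices pulled back from `E(π × π)` the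
cochain of `v^n` is `(g₁ - g₀) ⊗ ⋯ ⊗ (g_n - g_{n-1})` (`canonicalPowCochain_eq`), so `μ_*(v^n)` is
represented by `f ∘ D`, where `D` is the chain map `differenceMap`. Since `D` is equivariantly
homotopic to the identity (`face_homotopy`, `act_homotopy`), `f ∘ D` and `f` are cohomologous.

Essential classes come from Bredon classes: given `μ`, the function `(g₀, …, g_n) ↦ μ((g₁ - g₀) ⊗ ⋯
⊗ (g_n - g_{n-1}))` is an equivariant cocycle, by telescoping (`differencesHom_face_cone`). If `M`
is principal, a morphism `k[?, X] ⟶ M` amounts to an equivariant map from `X` to the principal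
component (`lift`, `hom_ext_of_value`), because an `H`-fixed point has an `H`-invariant value. The
function therefore extends to a Bredon cocycle, which `Φ` sends to `μ_*(v^n)`. For arbitrary `A`,
the principal module `fixedPoints A`, with values `A^H`, supplies the coefficients. -/

noncomputable section

namespace Bredon

/-! ### Chains on tuples -/

section Chains

variable (k : Type) [CommRing k] (X : Type)

/-- The free module on the `n`-tuples of elements of `X`. -/
abbrev Tuples (n : ℕ) : Type := (Fin n → X) →₀ k

variable {X}

/-- Prepending an entry to all tuples of a chain. -/
def cone (g : X) (n : ℕ) : Tuples k X n →ₗ[k] Tuples k X (n + 1) :=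
  Finsupp.lmapDomain k k fun y => (Fin.cons g y : Fin (n + 1) → X)

variable {k}

@[simp]
lemma cone_single (g : X) {n : ℕ} (y : Fin n → X) (c : k) :
    cone k g n (Finsupp.single y c) = Finsupp.single (Fin.cons g y : Fin (n + 1) → X) c :=
  Finsupp.mapDomain_single

variable (k X) in
/-- The product of a chain of points and a chain of tuples. -/
def join (n : ℕ) : (X →₀ k) →ₗ[k] Tuples k X n →ₗ[k] Tuples k X (n + 1) :=
  Finsupp.linearCombination k fun g => cone k g n

@[simp]
lemma join_single (g : X) {n : ℕ} (y : Tuples k X n) :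
    join k X n (Finsupp.single g 1) y = cone k g n y := by
  simp [join]

variable (k X) in
/-- The alternating sum of the maps which omit an entry. -/
def face (n : ℕ) : Tuples k X (n + 1) →ₗ[k] Tuples k X n :=
  Finsupp.linearCombination k fun x =>
    ∑ j : Fin (n + 1), (-1 : k) ^ (j : ℕ) • Finsupp.single (x ∘ j.succAbove) 1

lemma face_single {n : ℕ} (x : Fin (n + 1) → X) :
    face k X n (Finsupp.single x 1) =
      ∑ j : Fin (n + 1), (-1 : k) ^ (j : ℕ) • Finsupp.single (x ∘ j.succAbove) 1 := by
  simp [face]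

lemma tuples_hom_ext {n : ℕ} {N : Type} [AddCommGroup N] [Module k N]
    {f f' : Tuples k X n →ₗ[k] N}
    (h : ∀ x, f (Finsupp.single x 1) = f' (Finsupp.single x 1)) : f = f' :=
  Finsupp.lhom_ext' fun x => LinearMap.ext_ring (h x)

lemma single_eq_cone {n : ℕ} (x : Fin (n + 1) → X) :
    (Finsupp.single x 1 : Tuples k X (n + 1)) = cone k (x 0) n (Finsupp.single (Fin.tail x) 1) := by
  rw [cone_single, Fin.cons_self_tail]

/-- `face k X 0` is the augmentation: 0-tuples are multiples of the empty tuple. Together with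
`face_cone_succ` this makes the cone a contraction of the augmented complex. -/
lemma face_cone_zero (g : X) (y : Tuples k X 0) : face k X 0 (cone k g 0 y) = y := by
  have h : face k X 0 ∘ₗ cone k g 0 = LinearMap.id := tuples_hom_ext fun x => by
    simp [face_single]
  exact LinearMap.congr_fun h y

lemma face_cone_succ (g : X) {n : ℕ} (y : Tuples k X (n + 1)) :
    face k X (n + 1) (cone k g (n + 1) y) = y - cone k g n (face k X n y) := by
  have h : face k X (n + 1) ∘ₗ cone k g (n + 1) = LinearMap.id - cone k g n ∘ₗ face k X n :=
    tuples_hom_ext fun x => by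
      have h1 (j : Fin (n + 1)) : (Fin.cons g x : Fin (n + 2) → X) ∘ j.succ.succAbove =
          Fin.cons g (x ∘ j.succAbove) := by
        funext i
        refine Fin.cases ?_ (fun i => ?_) i <;> simp
      have h0 : (Fin.cons g x : Fin (n + 2) → X) ∘ (0 : Fin (n + 2)).succAbove = x := by
        funext i
        simp
      simp only [LinearMap.comp_apply, cone_single, face_single, LinearMap.sub_apply,
        LinearMap.id_apply, map_sum, map_smul]
      rw [Fin.sum_univ_succ, h0, sub_eq_add_neg, ← Finset.sum_neg_distrib]
      simp only [h1, Fin.val_succ, pow_succ, mul_neg_one, neg_smul, Fin.val_zero, pow_zero,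
        one_smul]
  exact LinearMap.congr_fun h y

/-- Every basis tuple is a cone over its tail, so the cone formula gives this by induction without a
double sum. -/
lemma face_face {n : ℕ} (x : Tuples k X (n + 2)) : face k X n (face k X (n + 1) x) = 0 := by
  induction n with
  | zero =>
    have h : face k X 0 ∘ₗ face k X 1 = 0 := tuples_hom_ext fun x => by
      rw [LinearMap.comp_apply, single_eq_cone, face_cone_succ, map_sub, face_cone_zero, sub_self]
      rfl
    exact LinearMap.congr_fun h x
  | succ n ih =>
    have h : face k X (n + 1) ∘ₗ face k X (n + 2) = 0 := tuples_hom_ext fun x => by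
      rw [LinearMap.comp_apply, single_eq_cone, face_cone_succ, map_sub, face_cone_succ, ih,
        map_zero, sub_zero, sub_self]
      rfl
    exact LinearMap.congr_fun h x

variable {G : Type} [Group G] [MulAction G X]

variable (k X) in
/-- The diagonal action on chains. -/
def act (n : ℕ) (a : G) : Tuples k X n →ₗ[k] Tuples k X n :=
  Finsupp.lmapDomain k k fun x => a • x

@[simp]
lemma act_single {n : ℕ} (a : G) (x : Fin n → X) (c : k) :
    act k X n a (Finsupp.single x c) = Finsupp.single (a • x) c :=
  Finsupp.mapDomain_single

lemma smul_cons {n : ℕ} (a : G) (g : X) (y : Fin n → X) :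
    a • (Fin.cons g y : Fin (n + 1) → X) = Fin.cons (a • g) (a • y) := by
  funext i
  refine Fin.cases ?_ (fun i => ?_) i <;> simp

lemma act_cone {n : ℕ} (a : G) (g : X) (y : Tuples k X n) :
    act k X (n + 1) a (cone k g n y) = cone k (a • g) n (act k X n a y) := by
  have h : act k X (n + 1) a ∘ₗ cone k g n = cone k (a • g) n ∘ₗ act k X n a :=
    tuples_hom_ext fun x => by simp [smul_cons]
  exact LinearMap.congr_fun h y

lemma act_face {n : ℕ} (a : G) (x : Tuples k X (n + 1)) :
    act k X n a (face k X n x) = face k X n (act k X (n + 1) a x) := by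
  have h : act k X n a ∘ₗ face k X n = face k X n ∘ₗ act k X (n + 1) a :=
    tuples_hom_ext fun x => by
      simp only [LinearMap.comp_apply, act_single, face_single, map_sum, map_smul]
      rfl
  exact LinearMap.congr_fun h x

end Chains

/-! ### Chains with coefficients in the powers of the augmentation ideal -/

variable {k : Type} [CommRing k] {π : Type} [Group π]

variable (k) in
/-- The difference of two points, an element of the augmentation ideal. -/
def difference (g h : TwoSided π) : augIdeal k π :=
  (⟨Finsupp.single h 1 - Finsupp.single g 1, by simp [augmentation]⟩ :
    LinearMap.ker (augmentation k π))

lemma rho_difference (a : π × π) (g h : TwoSided π) :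
    (augIdeal k π).ρ a (difference k g h) = difference k (a • g) (a • h) := by
  refine Subtype.ext ?_
  change regular k π a (Finsupp.single h 1 - Finsupp.single g 1) = _
  rw [map_sub]
  simp [regular, Finsupp.mapDomain_single, difference]

lemma difference_add (g h l : TwoSided π) :
    difference k g h + difference k h l = difference k g l := by
  refine Subtype.ext ?_
  change (Finsupp.single h 1 - Finsupp.single g 1) + (Finsupp.single l 1 - Finsupp.single h 1) =
    (Finsupp.single l 1 - Finsupp.single g 1 : TwoSided π →₀ k)
  abel

variable (k) in
/-- The element `(g₁ - g) ⊗ (g₂ - g₁) ⊗ ⋯ ⊗ (g_n - g_{n-1})` of `I^n`. -/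
def differences : (n : ℕ) → TwoSided π → (Fin n → TwoSided π) → idealPow k π n
  | 0, _, _ => (1 : k)
  | n + 1, g, y =>
    (difference k g (y 0) ⊗ₜ[k] differences n (y 0) (Fin.tail y) : augIdeal k π ⊗[k] idealPow k π n)

lemma rho_differences {n : ℕ} (a : π × π) (g : TwoSided π) (y : Fin n → TwoSided π) :
    (idealPow k π n).ρ a (differences k n g y) = differences k n (a • g) (a • y) := by
  induction n generalizing g with
  | zero => rfl
  | succ n ih =>
    change ((augIdeal k π).ρ a (difference k g (y 0)) ⊗ₜ[k]
      (idealPow k π n).ρ a (differences k n (y 0) (Fin.tail y)) :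
        augIdeal k π ⊗[k] idealPow k π n) = _
    rw [ih, rho_difference]
    rfl

variable (k) in
/-- The linear extension of `differences`. -/
def differencesHom (n : ℕ) (g : TwoSided π) : Tuples k (TwoSided π) n →ₗ[k] idealPow k π n :=
  Finsupp.linearCombination k (differences k n g)

@[simp]
lemma differencesHom_single {n : ℕ} (g : TwoSided π) (y : Fin n → TwoSided π) :
    differencesHom k n g (Finsupp.single y 1) = differences k n g y := by
  simp [differencesHom]

lemma differencesHom_cone {n : ℕ} (g h : TwoSided π) (y : Tuples k (TwoSided π) n) :
    differencesHom k (n + 1) g (cone k h n y) =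
      (difference k g h ⊗ₜ[k] differencesHom k n h y : augIdeal k π ⊗[k] idealPow k π n) := by
  have e : differencesHom k (n + 1) g ∘ₗ cone k h n =
      (TensorProduct.mk k (augIdeal k π) (idealPow k π n) (difference k g h)) ∘ₗ
        differencesHom k n h := by
    refine tuples_hom_ext fun x => ?_
    change differencesHom k (n + 1) g (cone k h n (Finsupp.single x 1)) =
      (difference k g h ⊗ₜ[k] differencesHom k n h (Finsupp.single x 1) :
        augIdeal k π ⊗[k] idealPow k π n)
    rw [cone_single, differencesHom_single, differencesHom_single]
    rfl
  exact LinearMap.congr_fun e y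

/-- Telescoping: for `y` with first entry `x₀`, the terms with leading factors `x₀ - g` and `h - g`
combine to one with `x₀ - h`; the remaining faces are handled by induction. This is the cocycle
identity for `differences`. -/
lemma differencesHom_face_cone {n : ℕ} (g h : TwoSided π) (y : Tuples k (TwoSided π) n) :
    differencesHom k n g (face k (TwoSided π) n (cone k h n y)) = differencesHom k n h y := by
  induction n generalizing g h with
  | zero =>
    rw [face_cone_zero]
    rfl
  | succ n ih =>
    suffices e : differencesHom k (n + 1) g ∘ₗ face k (TwoSided π) (n + 1) ∘ₗ cone k h (n + 1) =
        differencesHom k (n + 1) h from LinearMap.congr_fun e y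
    refine tuples_hom_ext fun x => ?_
    rw [LinearMap.comp_apply, LinearMap.comp_apply, face_cone_succ, map_sub, differencesHom_cone]
    rw [single_eq_cone, ih, differencesHom_cone, differencesHom_cone, ← difference_add g h (x 0),
      TensorProduct.add_tmul]
    exact add_sub_cancel_left _ _

variable (k π) in
/-- The inclusion of `I^n` into the free module on the `n`-tuples. -/
def idealPowToTuples : (n : ℕ) → idealPow k π n →ₗ[k] Tuples k (TwoSided π) n
  -- `I^0 = k` is identified with the multiples of the empty tuple.
  | 0 => LinearMap.toSpanSingleton k _ (Finsupp.single default 1)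
  | n + 1 => TensorProduct.lift
      (((join k (TwoSided π) n).domRestrict (LinearMap.ker (augmentation k π))).compl₂
        (idealPowToTuples n))

lemma idealPowToTuples_tmul {n : ℕ} (v : augIdeal k π) (x : idealPow k π n) :
    idealPowToTuples k π (n + 1) (v ⊗ₜ[k] x : augIdeal k π ⊗[k] idealPow k π n) =
      join k (TwoSided π) n (show LinearMap.ker (augmentation k π) from v).1
        (idealPowToTuples k π n x) := rfl

lemma augmentation_coe (v : augIdeal k π) :
    augmentation k π (show LinearMap.ker (augmentation k π) from v).1 = 0 :=
  LinearMap.mem_ker.1 (show LinearMap.ker (augmentation k π) from v).2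

lemma idealPow_succ_induction {n : ℕ} {p : idealPow k π (n + 1) → Prop}
    (x : idealPow k π (n + 1))
    (zero : p 0) (add : ∀ x y, p x → p y → p (x + y))
    (tmul : ∀ (v : augIdeal k π) (y : idealPow k π n),
      p (v ⊗ₜ[k] y : augIdeal k π ⊗[k] idealPow k π n)) : p x :=
  TensorProduct.induction_on (motive := p) (x : augIdeal k π ⊗[k] idealPow k π n) zero tmul add

lemma act_join {n : ℕ} (a : π × π) (v : TwoSided π →₀ k) (y : Tuples k (TwoSided π) n) :
    act k (TwoSided π) (n + 1) a (join k (TwoSided π) n v y) =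
      join k (TwoSided π) n (regular k π a v) (act k (TwoSided π) n a y) := by
  induction v using Finsupp.induction_linear with
  | zero => simp
  | add v w hv hw => simp only [map_add, LinearMap.add_apply, hv, hw]
  | single g c =>
    rw [← mul_one c, ← smul_eq_mul, ← Finsupp.smul_single]
    simp only [map_smul, LinearMap.smul_apply, join_single, act_cone]
    simp [regular]

lemma act_idealPowToTuples {n : ℕ} (a : π × π) (x : idealPow k π n) :
    act k (TwoSided π) n a (idealPowToTuples k π n x) =
      idealPowToTuples k π n ((idealPow k π n).ρ a x) := by
  induction n with
  | zero =>
    have h (c : k) : act k (TwoSided π) 0 a (c • Finsupp.single default 1) =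
        c • Finsupp.single default 1 := by
      rw [map_smul, act_single]
      congr 2
      exact Subsingleton.elim _ _
    exact h x
  | succ n ih =>
    induction x using idealPow_succ_induction with
    | zero => simp only [map_zero]
    | add x y hx hy => simp only [map_add, hx, hy]
    | tmul v y =>
      rw [idealPowToTuples_tmul, act_join, ih]
      rfl

omit [Group π] in
-- The cone formula extended linearly in the apex. For `v` in the augmentation ideal the first term
-- vanishes, which is why `I^n` lands in the cycles.
lemma face_join {n : ℕ} (v : TwoSided π →₀ k) (y : Tuples k (TwoSided π) (n + 1)) :
    face k (TwoSided π) (n + 1) (join k (TwoSided π) (n + 1) v y) =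
      augmentation k π v • y - join k (TwoSided π) n v (face k (TwoSided π) n y) := by
  induction v using Finsupp.induction_linear with
  | zero => simp
  | add v w hv hw =>
    simp only [map_add, LinearMap.add_apply, hv, hw, add_smul]
    abel
  | single g c =>
    rw [← mul_one c, ← smul_eq_mul, ← Finsupp.smul_single]
    simp only [map_smul, LinearMap.smul_apply, join_single, face_cone_succ, smul_sub]
    simp [augmentation]

omit [Group π] in
lemma face_join_zero (v : TwoSided π →₀ k) (y : Tuples k (TwoSided π) 0) :
    face k (TwoSided π) 0 (join k (TwoSided π) 0 v y) = augmentation k π v • y := by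
  induction v using Finsupp.induction_linear with
  | zero => simp
  | add v w hv hw => simp only [map_add, LinearMap.add_apply, hv, hw, add_smul]
  | single g c =>
    rw [← mul_one c, ← smul_eq_mul, ← Finsupp.smul_single]
    simp only [map_smul, LinearMap.smul_apply, join_single, face_cone_zero]
    simp [augmentation]

lemma face_idealPowToTuples {n : ℕ} (x : idealPow k π (n + 1)) :
    face k (TwoSided π) n (idealPowToTuples k π (n + 1) x) = 0 := by
  induction n with
  | zero =>
    induction x using idealPow_succ_induction with
    | zero => simp only [map_zero]
    | add x y hx hy => simp only [map_add, hx, hy, add_zero]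
    | tmul v y =>
      rw [idealPowToTuples_tmul, face_join_zero, augmentation_coe, zero_smul]
  | succ n ih =>
    induction x using idealPow_succ_induction with
    | zero => simp only [map_zero]
    | add x y hx hy => simp only [map_add, hx, hy, add_zero]
    | tmul v y =>
      rw [idealPowToTuples_tmul, face_join, ih, augmentation_coe, zero_smul, map_zero, sub_zero]

/-- The image of `I^n` consists of cycles, so the correction term in the cone formula disappears,
whatever the apex. -/
lemma face_cone_idealPowToTuples {n : ℕ} (g : TwoSided π) (x : idealPow k π n) :
    face k (TwoSided π) n (cone k g n (idealPowToTuples k π n x)) = idealPowToTuples k π n x := by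
  cases n with
  | zero => exact face_cone_zero _ _
  | succ n => rw [face_cone_succ, face_idealPowToTuples, map_zero, sub_zero]

/-! ### The chain homotopy -/

variable (k π) in
/-- The chain map `(g₀, …, g_n) ↦ g₀ ⊗ (g₁ - g₀) ⊗ ⋯ ⊗ (g_n - g_{n-1})`. -/
def differenceMap : (n : ℕ) → Tuples k (TwoSided π) n →ₗ[k] Tuples k (TwoSided π) n
  -- The identity on the augmentation term: the chain map preserves augmentations.
  | 0 => LinearMap.id
  | n + 1 => Finsupp.linearCombination k fun x =>
      cone k (x 0) n (idealPowToTuples k π n (differences k n (x 0) (Fin.tail x)))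

lemma differenceMap_single {n : ℕ} (x : Fin (n + 1) → TwoSided π) :
    differenceMap k π (n + 1) (Finsupp.single x 1) =
      cone k (x 0) n (idealPowToTuples k π n (differences k n (x 0) (Fin.tail x))) := by
  simp [differenceMap]

lemma differenceMap_cone {n : ℕ} (g : TwoSided π) (y : Tuples k (TwoSided π) n) :
    differenceMap k π (n + 1) (cone k g n y) =
      cone k g n (idealPowToTuples k π n (differencesHom k n g y)) := by
  have e : differenceMap k π (n + 1) ∘ₗ cone k g n =
      cone k g n ∘ₗ idealPowToTuples k π n ∘ₗ differencesHom k n g :=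
    tuples_hom_ext fun x => by
      simp only [LinearMap.comp_apply, cone_single, differenceMap_single, differencesHom_single]
      rfl
  exact LinearMap.congr_fun e y

/-- Taking the face strips the apex `g₀`, leaving `(g₁ - g₀) ⊗ ⋯`. The faces of the tuple give the
same: the one without `g₀` contributes leading factor `g₁`, and by telescoping the others contribute
`-g₀`. -/
lemma face_differenceMap {n : ℕ} (x : Tuples k (TwoSided π) (n + 1)) :
    face k (TwoSided π) n (differenceMap k π (n + 1) x) =
      differenceMap k π n (face k (TwoSided π) n x) := by
  suffices e : face k (TwoSided π) n ∘ₗ differenceMap k π (n + 1) =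
      differenceMap k π n ∘ₗ face k (TwoSided π) n from LinearMap.congr_fun e x
  refine tuples_hom_ext fun x => ?_
  rw [LinearMap.comp_apply, LinearMap.comp_apply, single_eq_cone, differenceMap_cone,
    face_cone_idealPowToTuples]
  cases n with
  | zero =>
    rw [face_cone_zero]
    simp only [differencesHom_single]
    change (1 : k) • Finsupp.single default 1 = (Finsupp.single _ 1 : Tuples k (TwoSided π) 0)
    rw [one_smul]
    congr 1
    exact Subsingleton.elim _ _
  | succ n =>
    rw [face_cone_succ, map_sub, differenceMap_cone, single_eq_cone (Fin.tail x),
      differenceMap_cone, differencesHom_face_cone, differencesHom_cone, idealPowToTuples_tmul]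
    simp [difference]

variable (k π) in
/-- A natural chain homotopy between `differenceMap` and the identity. -/
def homotopy : (n : ℕ) → Tuples k (TwoSided π) n →ₗ[k] Tuples k (TwoSided π) (n + 1)
  | 0 => 0
  | n + 1 => Finsupp.linearCombination k fun x =>
      -- The bracket is a cycle by induction, and coning fills it in. The apex is the first vertex
      -- of `x` rather than a fixed point, which keeps the homotopy equivariant.
      cone k (x 0) (n + 1) (differenceMap k π (n + 1) (Finsupp.single x 1) - Finsupp.single x 1 -
        homotopy n (face k (TwoSided π) n (Finsupp.single x 1)))

lemma homotopy_single {n : ℕ} (x : Fin (n + 1) → TwoSided π) :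
    homotopy k π (n + 1) (Finsupp.single x 1) =
      cone k (x 0) (n + 1) (differenceMap k π (n + 1) (Finsupp.single x 1) - Finsupp.single x 1 -
        homotopy k π n (face k (TwoSided π) n (Finsupp.single x 1))) := by
  simp [homotopy]

lemma face_homotopy {n : ℕ} (x : Tuples k (TwoSided π) (n + 1)) :
    face k (TwoSided π) (n + 1) (homotopy k π (n + 1) x) =
      differenceMap k π (n + 1) x - x - homotopy k π n (face k (TwoSided π) n x) := by
  suffices e : face k (TwoSided π) (n + 1) ∘ₗ homotopy k π (n + 1) =
      differenceMap k π (n + 1) - LinearMap.id - homotopy k π n ∘ₗ face k (TwoSided π) n from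
    LinearMap.congr_fun e x
  refine tuples_hom_ext fun x => ?_
  simp only [LinearMap.comp_apply, LinearMap.sub_apply, LinearMap.id_apply]
  -- It remains to see that the bracket that was coned off is a cycle.
  rw [homotopy_single, face_cone_succ, sub_eq_self]
  simp only [map_sub (face k (TwoSided π) n), face_differenceMap]
  cases n with
  | zero => simp [homotopy, differenceMap]
  | succ n => rw [face_homotopy, face_face, map_zero, sub_zero, sub_self, map_zero]

lemma act_differenceMap {n : ℕ} (a : π × π) (x : Tuples k (TwoSided π) n) :
    act k (TwoSided π) n a (differenceMap k π n x) =
      differenceMap k π n (act k (TwoSided π) n a x) := by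
  cases n with
  | zero => rfl
  | succ n =>
    suffices e : act k (TwoSided π) (n + 1) a ∘ₗ differenceMap k π (n + 1) =
        differenceMap k π (n + 1) ∘ₗ act k (TwoSided π) (n + 1) a from LinearMap.congr_fun e x
    refine tuples_hom_ext fun x => ?_
    simp only [LinearMap.comp_apply, act_single, differenceMap_single, act_cone,
      act_idealPowToTuples, rho_differences]
    rfl

lemma act_homotopy {n : ℕ} (a : π × π) (x : Tuples k (TwoSided π) n) :
    act k (TwoSided π) (n + 1) a (homotopy k π n x) =
      homotopy k π n (act k (TwoSided π) n a x) := by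
  induction n with
  | zero => exact map_zero _
  | succ n ih =>
    suffices e : act k (TwoSided π) (n + 2) a ∘ₗ homotopy k π (n + 1) =
        homotopy k π (n + 1) ∘ₗ act k (TwoSided π) (n + 1) a from LinearMap.congr_fun e x
    refine tuples_hom_ext fun x => ?_
    simp only [LinearMap.comp_apply, act_single, homotopy_single, act_cone, map_sub, ih, act_face,
      act_differenceMap]
    rfl

/-! ### Classes and cocycles -/

lemma groupCohomology_π_eq_of_sub {G : Type} [Group G] {A : Rep.{0} k G} {n : ℕ}
    (z w : groupCohomology.cocycles A (n + 1)) (b : (Fin n → G) → A)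
    (h : ∀ a, (groupCohomology.iCocycles A (n + 1)).hom z a -
      (groupCohomology.iCocycles A (n + 1)).hom w a =
        (inhomogeneousCochains.d A n).hom b a) :
    groupCohomology.π A (n + 1) z = groupCohomology.π A (n + 1) w := by
  have e : z - w = groupCohomology.toCocycles A n (n + 1) b := by
    apply (ModuleCat.mono_iff_injective (groupCohomology.iCocycles A (n + 1))).1 inferInstance
    have h1 : (groupCohomology.iCocycles A (n + 1)) (groupCohomology.toCocycles A n (n + 1) b) =
        (groupCohomology.inhomogeneousCochains A).d n (n + 1) b :=
      congrArg (fun t => t.hom b)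
        ((groupCohomology.inhomogeneousCochains A).toCycles_i n (n + 1))
    rw [h1, groupCohomology.inhomogeneousCochains.d_def, map_sub]
    exact funext h
  have h2 : groupCohomology.π A (n + 1) (groupCohomology.toCocycles A n (n + 1) b) = 0 :=
    congrArg (fun t => t.hom b)
      ((groupCohomology.inhomogeneousCochains A).toCycles_comp_homologyπ n (n + 1))
  rw [← sub_eq_zero, ← map_sub, e, h2]

lemma cocycles_ext {G : Type} [Group G] {A : Rep.{0} k G} {n : ℕ}
    {z w : groupCohomology.cocycles A n}
    (h : ∀ a, (groupCohomology.iCocycles A n).hom z a =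
      (groupCohomology.iCocycles A n).hom w a) : z = w :=
  (ModuleCat.mono_iff_injective (groupCohomology.iCocycles A n)).1 inferInstance (funext h)

/-- The cocycle representing the image of the power of the canonical class. -/
lemma exists_cocycle_coeffMap {A : Rep.{0} k (π × π)} {n : ℕ} (μ : idealPow k π n ⟶ A) :
    ∃ z : groupCohomology.cocycles A n,
      groupCohomology.π A n z = (coeffMap μ n).hom (canonicalPow k π n) ∧
      ∀ a, (groupCohomology.iCocycles A n).hom z a = μ.hom (canonicalPowCochain n a) := by
  refine ⟨groupCohomology.cocyclesMap (MonoidHom.id _) μ n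
    (groupCohomology.cocyclesMk (canonicalPowCochain n) (d_canonicalPowCochain n)), ?_, ?_⟩
  · exact (groupCohomology.π_map_apply (MonoidHom.id _) μ n _).symm
  · intro a
    have h := congrArg (fun t => t.hom
      (groupCohomology.cocyclesMk (canonicalPowCochain n) (d_canonicalPowCochain n)))
      (HomologicalComplex.cyclesMap_i (groupCohomology.cochainsMap (MonoidHom.id _) μ) n)
    refine (congrFun h a).trans ?_
    have h' := groupCohomology.iCocycles_mk (A := idealPow k π n) (canonicalPowCochain n)
      (d_canonicalPowCochain (k := k) (π := π) n)
    exact congrArg (fun w : (Fin n → π × π) → idealPow k π n => μ.hom (w a)) h'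

/-- Reduces statements about `Φ` to explicit functions: the class downstairs is represented by the
values of a Bredon cocycle on the simplices. `exists_class` goes the other way, from a cocycle to a
class. -/
lemma exists_cocycle {M : OModule π k} {n : ℕ} (α : cohomology M n) :
    ∃ (f : freeModule (Fin (n + 1) → TwoSided π) ⟶ M)
      (z : groupCohomology.cocycles (principalComponent M) n),
      boundary k π n ≫ f = 0 ∧ groupCohomology.π _ n z = (phi M n).hom α ∧
      ∀ a, (groupCohomology.iCocycles _ n).hom z a =
        value (X := Fin (n + 1) → TwoSided π) f (simplex a) := by
  obtain ⟨c, rfl⟩ := (ModuleCat.epi_iff_surjective ((cochains M).homologyπ n)).1 inferInstance α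
  refine ⟨(cochains M).iCycles n c, HomologicalComplex.cyclesMap (phiCochains M) n c, ?_, ?_, ?_⟩
  · have h := congrArg (fun t => t.hom c) ((cochains M).iCycles_d n (n + 1))
    rw [cochains_d] at h
    exact h
  · exact (congrArg (fun t => t.hom c)
      (HomologicalComplex.homologyπ_naturality (phiCochains M) n)).symm
  · intro a
    exact congrFun (congrArg (fun t => t.hom c)
      (HomologicalComplex.cyclesMap_i (phiCochains M) n)) a

lemma exists_class {M : OModule π k} {n : ℕ} (f : freeModule (Fin (n + 1) → TwoSided π) ⟶ M)
    (hf : boundary k π n ≫ f = 0) :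
    ∃ (α : cohomology M n) (z : groupCohomology.cocycles (principalComponent M) n),
      groupCohomology.π _ n z = (phi M n).hom α ∧
      ∀ a, (groupCohomology.iCocycles _ n).hom z a =
        value (X := Fin (n + 1) → TwoSided π) f (simplex a) := by
  have hd : (cochains M).d n (n + 1) f = 0 := by
    rw [cochains_d]
    exact hf
  let c : (cochains M).cycles n := (cochains M).cyclesMk f (n + 1) (by simp) hd
  refine ⟨(cochains M).homologyπ n c, HomologicalComplex.cyclesMap (phiCochains M) n c, ?_, ?_⟩
  · exact (congrArg (fun t => t.hom c)
      (HomologicalComplex.homologyπ_naturality (phiCochains M) n)).symm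
  · intro a
    refine (congrFun (congrArg (fun t => t.hom c)
      (HomologicalComplex.cyclesMap_i (phiCochains M) n)) a).trans ?_
    have h : (cochains M).iCycles n c = f := (cochains M).i_cyclesMk f (n + 1) (by simp) hd
    exact congrArg (fun g : freeModule (Fin (n + 1) → TwoSided π) ⟶ M =>
      value (X := Fin (n + 1) → TwoSided π) g (simplex a)) h

/-! ### Classes in the image of `Φ` are essential -/

lemma simplex_zero {n : ℕ} (a : Fin n → π × π) : simplex a 0 = quotientMap 1 := by
  simp [simplex]

/-- Passage from inhomogeneous to homogeneous coordinates. In the cup product `a 0` acts on the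
remaining factors; it carries the simplex of the tail of `a` to the last vertices of `simplex a`, so
the differences line up. -/
lemma canonicalPowCochain_eq {n : ℕ} (a : Fin n → π × π) :
    (canonicalPowCochain n a : idealPow k π n) =
      differences k n (simplex a 0) (Fin.tail (simplex a)) := by
  induction n with
  | zero => rfl
  | succ n ih =>
    have h1 : simplex a 1 = a 0 • (simplex (Fin.tail a) 0) :=
      (congrFun (smul_simplex_succ a) 0).symm
    have h2 : a 0 • Fin.tail (simplex (Fin.tail a)) = Fin.tail (Fin.tail (simplex a)) := by
      funext i
      exact congrFun (smul_simplex_succ a) i.succ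
    have h3 : quotientMap (a 0) = simplex a 1 := by
      rw [h1, simplex_zero, ← quotientMap_mul, mul_one]
    change ((canonicalCochain (a 0) : augIdeal k π) ⊗ₜ[k]
      (idealPow k π n).ρ (a 0) (canonicalPowCochain n (Fin.tail a)) :
        augIdeal k π ⊗[k] idealPow k π n) = _
    rw [ih, rho_differences, h2, ← h1, simplex_zero]
    change (difference k (quotientMap 1) (quotientMap (a 0)) ⊗ₜ[k] _ :
        augIdeal k π ⊗[k] idealPow k π n) = _
    rw [h3]
    rfl

/-- For equivariant cochains, pulling back to simplices turns composition with `face` into the group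
coboundary. The face omitting the first vertex accounts for the term with the action of `a 0`. -/
lemma d_simplex {A : Rep.{0} k (π × π)} {n : ℕ} (b : Tuples k (TwoSided π) (n + 1) →ₗ[k] A)
    (hb : ∀ a x, b (act k (TwoSided π) (n + 1) a x) = A.ρ a (b x)) (a : Fin (n + 1) → π × π) :
    (inhomogeneousCochains.d A n).hom (fun a => b (Finsupp.single (simplex a) 1)) a =
      b (face k (TwoSided π) (n + 1) (Finsupp.single (simplex a) 1)) := by
  rw [inhomogeneousCochains.d_hom_apply, face_single, map_sum, Fin.sum_univ_succ (n := n + 1), ← hb, act_single,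
    smul_simplex_succ]
  simp only [simplex_contractNth, map_smul, Fin.val_zero, pow_zero, one_smul, Fin.val_succ,
    Fin.succAbove_zero]

/-- The homomorphism `x ↦ f (1 ⊗ x)` on `I^n` defined by an equivariant cocycle `f`. -/
def ofCocycle {A : Rep.{0} k (π × π)} {n : ℕ} (f : Tuples k (TwoSided π) (n + 1) →ₗ[k] A)
    (hf : ∀ a x, f (act k (TwoSided π) (n + 1) a x) = A.ρ a (f x))
    (hd : ∀ x, f (face k (TwoSided π) (n + 1) x) = 0) : idealPow k π n ⟶ A :=
  Rep.ofHom
    { toLinearMap := f ∘ₗ cone k (quotientMap 1) n ∘ₗ idealPowToTuples k π n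
      isIntertwining' := fun a => by
        refine LinearMap.ext fun x => ?_
        change f (cone k (quotientMap 1) n (idealPowToTuples k π n ((idealPow k π n).ρ a x))) =
          A.ρ a (f (cone k (quotientMap 1) n (idealPowToTuples k π n x)))
        rw [← hf, act_cone, act_idealPowToTuples, ← sub_eq_zero, ← map_sub]
        -- The cones over a cycle with apexes `1` and `a • 1` differ by the boundary of the double
        -- cone, on which `f` vanishes.
        have h := hd (cone k (a • quotientMap 1) (n + 1) (cone k (quotientMap 1) n
          (idealPowToTuples k π n ((idealPow k π n).ρ a x))))
        rwa [face_cone_succ, face_cone_idealPowToTuples] at h }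

/-- The linear extension of the values of a homomorphism on the free orbit. -/
def valueLinear {n : ℕ} {M : OModule π k} (f : freeModule (Fin n → TwoSided π) ⟶ M) :
    Tuples k (TwoSided π) n →ₗ[k] principalComponent M :=
  Finsupp.linearCombination k (value f)

@[simp]
lemma valueLinear_single {n : ℕ} {M : OModule π k} (f : freeModule (Fin n → TwoSided π) ⟶ M)
    (x : Fin n → TwoSided π) : valueLinear f (Finsupp.single x 1) = value f x := by
  simp [valueLinear]

lemma valueLinear_act {n : ℕ} {M : OModule π k} (f : freeModule (Fin n → TwoSided π) ⟶ M)
    (a : π × π) (x : Tuples k (TwoSided π) n) :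
    valueLinear f (act k (TwoSided π) n a x) = (principalComponent M).ρ a (valueLinear f x) := by
  have h : valueLinear f ∘ₗ act k (TwoSided π) n a =
      (principalComponent M).ρ a ∘ₗ valueLinear f := tuples_hom_ext fun x => by
    simp only [LinearMap.comp_apply, act_single, valueLinear_single, rho_value]
  exact LinearMap.congr_fun h x

lemma valueLinear_face_single {n : ℕ} {M : OModule π k}
    (f : freeModule (Fin (n + 1) → TwoSided π) ⟶ M) (x : Fin (n + 2) → TwoSided π) :
    valueLinear f (face k (TwoSided π) (n + 1) (Finsupp.single x 1)) =
      value (X := Fin (n + 2) → TwoSided π) (boundary k π n ≫ f) x := by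
  rw [value_boundary, face_single, map_sum]
  simp only [map_smul, valueLinear_single]

theorem isEssential_phi {M : OModule π k} {n : ℕ} (α : cohomology M n) :
    IsEssential ((phi M n).hom α) := by
  obtain ⟨f, z, hf, hz, hzf⟩ := exists_cocycle α
  have hd (x : Tuples k (TwoSided π) (n + 2)) :
      valueLinear f (face k (TwoSided π) (n + 1) x) = 0 := by
    have h : valueLinear f ∘ₗ face k (TwoSided π) (n + 1) = 0 := tuples_hom_ext fun x => by
      rw [LinearMap.comp_apply, valueLinear_face_single]
      exact congrArg (fun g => value (X := Fin (n + 2) → TwoSided π) g x) hf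
    exact LinearMap.congr_fun h x
  obtain ⟨w, hw, hwμ⟩ := exists_cocycle_coeffMap (ofCocycle (valueLinear f) (valueLinear_act f) hd)
  refine ⟨_, hw.symm.trans (Eq.trans ?_ hz)⟩
  have hw' (a : Fin n → π × π) : (groupCohomology.iCocycles _ n).hom w a =
      valueLinear f (differenceMap k π (n + 1) (Finsupp.single (simplex a) 1)) := by
    rw [hwμ, canonicalPowCochain_eq, differenceMap_single, simplex_zero]
    rfl
  have hz' (a : Fin n → π × π) : (groupCohomology.iCocycles _ n).hom z a =
      valueLinear f (Finsupp.single (simplex a) 1) := by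
    rw [hzf, valueLinear_single]
  -- The homotopy formula after applying the cocycle, which kills the face of the homotopy.
  have key (x : Tuples k (TwoSided π) (n + 1)) :
      valueLinear f (differenceMap k π (n + 1) x) - valueLinear f x =
        valueLinear f (homotopy k π n (face k (TwoSided π) n x)) := by
    have h := hd (homotopy k π (n + 1) x)
    rwa [face_homotopy, map_sub, map_sub, sub_eq_zero] at h
  cases n with
  | zero =>
    -- In degree zero the homotopy on the augmentation term is zero, so the cocycles coincide.
    refine congrArg _ (cocycles_ext fun a => ?_)
    rw [hw', hz', ← sub_eq_zero, key]
    exact map_zero _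
  | succ n =>
    refine groupCohomology_π_eq_of_sub _ _
      (fun a => (valueLinear f ∘ₗ homotopy k π (n + 1)) (Finsupp.single (simplex a) 1)) fun a => ?_
    rw [hw', hz', key, d_simplex]
    · rfl
    · intro a x
      rw [LinearMap.comp_apply, ← act_homotopy, valueLinear_act]
      rfl

/-! ### Homomorphisms to principal modules -/

/-- The equivariant map underlying a morphism of the orbit category. -/
abbrev orbitMap {K L : Orbit π} (j : K ⟶ L) :
    ((π × π) ⧸ K.H) →[π × π] ((π × π) ⧸ L.H) := j

lemma translate_comp {K L : Orbit π} (j : K ⟶ L) {b : π × π}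
    (hb : orbitMap j (QuotientGroup.mk 1) =
      QuotientGroup.mk b) :
    translate K 1 ≫ j = translate (freeOrbit π) b ≫ translate L 1 := by
  refine free_hom_ext ?_
  change orbitMap j
      ((1 : π × π) • (QuotientGroup.mk 1 : (π × π) ⧸ K.H)) =
    ofPoint (QuotientGroup.mk 1 : (π × π) ⧸ L.H)
      ((1 : π × π) • (QuotientGroup.mk b : (π × π) ⧸ (freeOrbit π).H))
  rw [one_smul, one_smul, hb, ofPoint_mk]
  exact congrArg QuotientGroup.mk (mul_one b).symm

/-- After restriction to the free orbit, a map of orbits sending the base coset to `b L` becomes the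
action of `b`. Naturality over all orbits is thereby reduced to equivariance of the principal
component. -/
lemma map_translate_map {M : OModule π k} {K L : Orbit π} (j : K ⟶ L) {b : π × π}
    (hb : orbitMap j (QuotientGroup.mk 1) =
      QuotientGroup.mk b) (m : M.obj (op L)) :
    (M.map (translate K 1).op).hom ((M.map j.op).hom m) =
      (principalComponent M).ρ b ((M.map (translate L 1).op).hom m) := by
  have h : M.map j.op ≫ M.map (translate K 1).op =
      M.map (translate L 1).op ≫ M.map (translate (freeOrbit π) b).op := by
    rw [← M.map_comp, ← M.map_comp, ← op_comp, ← op_comp, translate_comp j hb]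
  exact congrArg (fun t => t.hom m) h

lemma translate_freeOrbit_one : translate (freeOrbit π) (1 : π × π) = 𝟙 _ :=
  free_hom_ext (one_smul _ _)

/-- Naturality along the projection from the free orbit: a basis element over `K` is a `K`-fixed
point of `X`, and its restriction is the generator of that point. -/
lemma map_translate_app {X : Type} [MulAction (π × π) X] {M : OModule π k}
    (f : freeModule X ⟶ M) (K : Orbit π) (x : ((π × π) ⧸ K.H) →[π × π] X) :
    (M.map (translate K 1).op).hom
        ((f.app (op K)).hom (ModuleCat.freeMk (R := k) (x : (homSet X).obj (op K)))) =
      value f (x (QuotientGroup.mk 1)) := by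
  have h := congrArg (fun t => t.hom (ModuleCat.freeMk (R := k) (x : (homSet X).obj (op K))))
    (f.naturality (translate K 1).op)
  refine Eq.trans h.symm ?_
  have h' : ((freeModule X : OModule π k).map (translate K 1).op).hom
      (ModuleCat.freeMk (R := k) (x : (homSet X).obj (op K))) =
        generator (x (QuotientGroup.mk 1)) := by
    refine (ModuleCat.free_map_apply ((homSet X).map (translate K 1).op)
      (x : (homSet X).obj (op K))).trans (congrArg ModuleCat.freeMk (free_hom_ext ?_))
    change x ((1 : π × π) • (QuotientGroup.mk 1 : (π × π) ⧸ K.H)) =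
      (1 : π × π) • x (QuotientGroup.mk 1)
    rw [one_smul, one_smul]
  exact congrArg (f.app (op (freeOrbit π))).hom h'

/-- A homomorphism to a principal module is determined by its principal component. -/
lemma hom_ext_of_value {X : Type} [MulAction (π × π) X] {M : OModule π k}
    (hM : IsPrincipalModule M) {f f' : freeModule X ⟶ M} (h : ∀ x, value f x = value f' x) :
    f = f' := by
  refine NatTrans.ext (funext fun K => ModuleCat.free_hom_ext fun x => ?_)
  refine (hM K.unop).injOn (Set.mem_univ _) (Set.mem_univ _) ?_
  exact (map_translate_app f K.unop x).trans ((h _).trans (map_translate_app f' K.unop x).symm)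

section Lift

variable {X : Type} [MulAction (π × π) X] {M : OModule π k}

/-- The image of the base coset is fixed by `K`, so its value is `K`-invariant and comes from `M` at
the orbit of `K`. -/
lemma exists_lift_point (hM : IsPrincipalModule M) (f : X → principalComponent M)
    (hf : ∀ a x, f (a • x) = (principalComponent M).ρ a (f x)) (K : Orbit π) (x : ((π × π) ⧸ K.H) →[π × π] X) :
    ∃ m : M.obj (op K), (M.map (translate K 1).op).hom m = f (x (QuotientGroup.mk 1)) := by
  have h : f (x (QuotientGroup.mk 1)) ∈ {a | ∀ h ∈ K.H, (principalComponent M).ρ h a = a} := by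
    intro a ha
    rw [← hf, ← map_smul]
    congr 2
    change (QuotientGroup.mk (a * 1) : (π × π) ⧸ K.H) = QuotientGroup.mk 1
    rw [mul_one, QuotientGroup.eq, mul_one]
    exact inv_mem ha
  obtain ⟨m, -, hm⟩ := (hM K).surjOn h
  exact ⟨m, hm⟩

/-- The homomorphism from a free module to a principal module which extends an equivariant map
to the principal component. -/
def lift (hM : IsPrincipalModule M) (f : X → principalComponent M)
    (hf : ∀ a x, f (a • x) = (principalComponent M).ρ a (f x)) : (freeModule X : OModule π k) ⟶ M where
  app K := ModuleCat.freeDesc (↾fun x => (exists_lift_point hM f hf K.unop x).choose)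
  naturality K L j := by
    refine ModuleCat.free_hom_ext fun x => ?_
    -- Restriction to the free orbit is injective, so naturality may be checked there, where the
    -- chosen lifts have known values.
    refine (hM L.unop).injOn (Set.mem_univ _) (Set.mem_univ _) ?_
    let y : ((π × π) ⧸ L.unop.H) →[π × π] X :=
      MulActionHom.comp (x : ((π × π) ⧸ K.unop.H) →[π × π] X) j.unop
    let N := (M.map (translate L.unop 1).op).hom
    have h1 : (ModuleCat.freeDesc
          (↾fun x => (exists_lift_point hM f hf L.unop x).choose :
            (homSet X).obj L ⟶ (forget _).obj (M.obj L))).hom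
        (((freeModule X : OModule π k).map j).hom (ModuleCat.freeMk x)) =
          (exists_lift_point hM f hf L.unop y).choose := by
      refine (congrArg _ (ModuleCat.free_map_apply ((homSet X).map j) x)).trans ?_
      exact ModuleCat.freeDesc_apply _ _
    have h2 : (ModuleCat.freeDesc
          (↾fun x => (exists_lift_point hM f hf K.unop x).choose :
            (homSet X).obj K ⟶ (forget _).obj (M.obj K))).hom (ModuleCat.freeMk x) =
          (exists_lift_point hM f hf K.unop x).choose := ModuleCat.freeDesc_apply _ _
    refine (congrArg N h1).trans (Eq.trans ?_ (congrArg (fun m => N ((M.map j).hom m)) h2).symm)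
    refine (exists_lift_point hM f hf L.unop y).choose_spec.trans ?_
    obtain ⟨b, hb⟩ := QuotientGroup.mk_surjective
      (orbitMap j.unop (QuotientGroup.mk 1))
    refine Eq.trans ?_ (map_translate_map j.unop hb.symm _).symm
    refine Eq.trans ?_ (congrArg ((principalComponent M).ρ b)
      (exists_lift_point hM f hf K.unop x).choose_spec).symm
    let x' : ((π × π) ⧸ K.unop.H) →[π × π] X := x
    have hy : y (QuotientGroup.mk 1) = b • x' (QuotientGroup.mk 1) := by
      change x' (orbitMap j.unop (QuotientGroup.mk 1)) = _
      rw [← hb, ← map_smul]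
      exact congrArg x' (congrArg QuotientGroup.mk (mul_one b).symm)
    exact (congrArg f hy).trans (hf _ _)

/-- At the free orbit the projection is the identity, so the chosen preimage is the prescribed value
itself. -/
lemma value_lift (hM : IsPrincipalModule M) (f : X → principalComponent M)
    (hf : ∀ a x, f (a • x) = (principalComponent M).ρ a (f x)) (x : X) : value (lift hM f hf) x = f x := by
  have h1 : value (lift hM f hf) x =
      (exists_lift_point hM f hf (freeOrbit π) (ofPoint x)).choose :=
    ModuleCat.freeDesc_apply
      (↾fun x => (exists_lift_point hM f hf (freeOrbit π) x).choose :
        (homSet X).obj (op (freeOrbit π)) ⟶ (forget _).obj (M.obj (op (freeOrbit π))))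
      (ofPoint x : ((π × π) ⧸ (freeOrbit π).H) →[π × π] X)
  have h2 := (exists_lift_point hM f hf (freeOrbit π) (ofPoint x)).choose_spec.trans
    (congrArg f (one_smul (π × π) x))
  have h3 (m : M.obj (op (freeOrbit π))) :
      (M.map (translate (freeOrbit π) 1).op).hom m = m := by
    rw [translate_freeOrbit_one, op_id, M.map_id]
    rfl
  rw [h1, ← h2]
  exact (h3 _).symm

end Lift

theorem exists_phi_eq {M : OModule π k} (hM : IsPrincipalModule M) {n : ℕ}
    {β : groupCohomology (principalComponent M) n} (hβ : IsEssential β) :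
    ∃ α, (phi M n).hom α = β := by
  obtain ⟨μ, rfl⟩ := hβ
  let f (x : Fin (n + 1) → TwoSided π) : principalComponent M :=
    μ.hom (differences k n (x 0) (Fin.tail x))
  have hf (a : π × π) (x : Fin (n + 1) → TwoSided π) :
      f (a • x) = (principalComponent M).ρ a (f x) := by
    change _ = (principalComponent M).ρ a (μ.hom (differences k n (x 0) (Fin.tail x)))
    rw [← Rep.hom_comm_apply, rho_differences]
    rfl
  -- Since `M` is principal, the cocycle condition need only be checked on the principal component,
  -- where it is telescoping.
  have hd : boundary k π n ≫ lift hM f hf = 0 := by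
    refine hom_ext_of_value (X := Fin (n + 2) → TwoSided π) hM fun x => ?_
    have h' (g : TwoSided π) (y : Tuples k (TwoSided π) n) :
        valueLinear (lift hM f hf) (cone k g n y) = μ.hom (differencesHom k n g y) := by
      have e : valueLinear (lift hM f hf) ∘ₗ cone k g n =
          μ.hom.toLinearMap ∘ₗ differencesHom k n g := tuples_hom_ext fun x => by
        change valueLinear (lift hM f hf) (cone k g n (Finsupp.single x 1)) =
          μ.hom (differencesHom k n g (Finsupp.single x 1))
        rw [cone_single, valueLinear_single, value_lift, differencesHom_single]
        rfl
      exact LinearMap.congr_fun e y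
    refine (valueLinear_face_single _ _).symm.trans ?_
    rw [single_eq_cone, face_cone_succ, single_eq_cone (Fin.tail x), map_sub, h', h',
      differencesHom_face_cone, sub_self]
    rfl
  obtain ⟨α, z, hz, hzf⟩ := exists_class (lift hM f hf) hd
  obtain ⟨w, hw, hwμ⟩ := exists_cocycle_coeffMap μ
  refine ⟨α, ?_⟩
  rw [← hz, ← hw]
  -- No homotopy is needed in this direction: the two representing cochains are equal.
  refine congrArg _ (cocycles_ext fun a => ?_)
  rw [hzf, hwμ, value_lift, canonicalPowCochain_eq]

/-! ### The principal module of a representation -/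

/-- The equivariant maps from an orbit to a representation. -/
def equivariantMaps (A : Rep.{0} k (π × π)) (K : Orbit π) : Submodule k ((π × π) ⧸ K.H → A) where
  carrier := {u | ∀ (a : π × π) q, u (a • q) = A.ρ a (u q)}
  zero_mem' a q := (map_zero _).symm
  add_mem' hu hv a q := by simp only [Pi.add_apply, map_add, hu a q, hv a q]
  smul_mem' c u hu a q := by simp only [Pi.smul_apply, map_smul, hu a q]

/-- The module over the orbit category which sends an orbit to the equivariant maps from it to a
representation. -/
def fixedPoints (A : Rep.{0} k (π × π)) : OModule π k where
  obj K := ModuleCat.of k (equivariantMaps A K.unop)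
  map j := ModuleCat.ofHom
    ((LinearMap.funLeft k A (orbitMap j.unop)).restrict fun u hu a q =>
      (congrArg u (map_smul (orbitMap j.unop) a q)).trans (hu a _))
  map_id _ := rfl
  map_comp _ _ := rfl

lemma equivariantMaps_ext {A : Rep.{0} k (π × π)} {K : Orbit π} {u v : equivariantMaps A K}
    (h : u.1 (QuotientGroup.mk 1) = v.1 (QuotientGroup.mk 1)) : u = v := by
  refine Subtype.ext (funext fun q => ?_)
  induction q using QuotientGroup.induction_on with
  | H g =>
    have e : (QuotientGroup.mk g : (π × π) ⧸ K.H) =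
        g • (QuotientGroup.mk 1 : (π × π) ⧸ K.H) :=
      congrArg QuotientGroup.mk (mul_one g).symm
    rw [e, u.2, v.2, h]

/-- The equivariant map `g ↦ g a` belonging to an invariant element `a`. -/
def equivariantMapOf {A : Rep.{0} k (π × π)} (K : Orbit π) (a : A)
    (ha : ∀ h ∈ K.H, A.ρ h a = a) : equivariantMaps A K :=
  ⟨fun q => Quotient.liftOn' q (fun g => A.ρ g a) (by
      intro g h e
      rw [QuotientGroup.leftRel_apply] at e
      have := ha _ e
      rw [← mul_inv_cancel_left g h, map_mul, Module.End.mul_apply, this]), by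
    intro g q
    induction q using QuotientGroup.induction_on with
    | H h => exact congrArg (fun t => t a) (map_mul A.ρ g h)⟩

lemma equivariantMapOf_mk_one {A : Rep.{0} k (π × π)} (K : Orbit π) (a : A)
    (ha : ∀ h ∈ K.H, A.ρ h a = a) :
    (equivariantMapOf K a ha).1 (QuotientGroup.mk 1) = a := by
  change A.ρ 1 a = a
  rw [map_one]
  rfl

lemma fixedPoints_map_translate_one (A : Rep.{0} k (π × π)) (K : Orbit π)
    (u : equivariantMaps A K) :
    (show equivariantMaps A (freeOrbit π) from
      ((fixedPoints A).map (translate K 1).op).hom u).1 (QuotientGroup.mk 1) =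
        u.1 (QuotientGroup.mk 1) :=
  congrArg u.1 (one_smul (π × π) (QuotientGroup.mk 1 : (π × π) ⧸ K.H))

lemma fixedPoints_rho (A : Rep.{0} k (π × π)) (a : π × π)
    (u : equivariantMaps A (freeOrbit π)) :
    (show equivariantMaps A (freeOrbit π) from
      (principalComponent (fixedPoints A)).ρ a u).1 (QuotientGroup.mk 1) =
        A.ρ a (u.1 (QuotientGroup.mk 1)) := by
  rw [← u.2]
  refine congrArg u.1 ((one_smul (π × π)
    (QuotientGroup.mk a : (π × π) ⧸ (freeOrbit π).H)).trans ?_)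
  exact congrArg QuotientGroup.mk (mul_one a).symm

/-- The principal component of the module of a representation. -/
def principalComponentFixedPoints (A : Rep.{0} k (π × π)) :
    principalComponent (fixedPoints A) ≅ A :=
  Rep.mkIso (ρ := (principalComponent (fixedPoints A)).ρ) (σ := A.ρ)
    { toFun := fun u => (show equivariantMaps A (freeOrbit π) from u).1 (QuotientGroup.mk 1)
      map_add' := fun _ _ => rfl
      map_smul' := fun _ _ => rfl
      invFun := fun a => equivariantMapOf (freeOrbit π) a fun h hh => by
        rw [Subgroup.mem_bot.1 hh, map_one]
        rfl
      left_inv := fun u => equivariantMaps_ext (equivariantMapOf_mk_one _ _ _)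
      right_inv := fun a => equivariantMapOf_mk_one _ _ _
      isIntertwining' := fun a => LinearMap.ext fun u => fixedPoints_rho A a u }

/-- An equivariant map from an orbit is determined by its value at the base coset, which may be any
element invariant under the isotropy group. -/
lemma isPrincipalModule_fixedPoints (A : Rep.{0} k (π × π)) :
    IsPrincipalModule (fixedPoints A) := by
  intro K
  refine ⟨fun u _ h hh => ?_, fun u _ v _ e => ?_, fun v hv => ?_⟩
  · refine equivariantMaps_ext ((fixedPoints_rho A h _).trans ?_)
    have e := fixedPoints_map_translate_one A K u
    refine (congrArg (A.ρ h) e).trans (Eq.trans ?_ e.symm)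
    refine (Subtype.prop (show equivariantMaps A K from u) h _).symm.trans ?_
    refine congrArg (show equivariantMaps A K from u).1 ?_
    change (QuotientGroup.mk (h * 1) : (π × π) ⧸ K.H) = QuotientGroup.mk 1
    rw [mul_one, QuotientGroup.eq, mul_one]
    exact inv_mem hh
  · refine equivariantMaps_ext ((fixedPoints_map_translate_one A K u).symm.trans
      (Eq.trans ?_ (fixedPoints_map_translate_one A K v)))
    exact congrArg (fun w : equivariantMaps A (freeOrbit π) => w.1 (QuotientGroup.mk 1)) e
  · refine ⟨equivariantMapOf K ((show equivariantMaps A (freeOrbit π) from v).1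
      (QuotientGroup.mk 1)) fun h hh => ?_, Set.mem_univ _, ?_⟩
    · refine (fixedPoints_rho A h v).symm.trans ?_
      exact congrArg (fun w : equivariantMaps A (freeOrbit π) => w.1 (QuotientGroup.mk 1)) (hv h hh)
    · exact equivariantMaps_ext
        ((fixedPoints_map_translate_one A K _).trans (equivariantMapOf_mk_one _ _ _))

/-! ### Change of coefficients -/

lemma coeffMap_comp {A B C : Rep.{0} k (π × π)} (f : A ⟶ B) (g : B ⟶ C) (n : ℕ)
    (β : groupCohomology A n) :
    (coeffMap (f ≫ g) n).hom β = (coeffMap g n).hom ((coeffMap f n).hom β) :=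
  congrArg (fun t => t.hom β) ((groupCohomology.functor k (π × π) n).map_comp f g)

lemma IsEssential.coeffMap {A B : Rep.{0} k (π × π)} {n : ℕ} {β : groupCohomology A n}
    (h : IsEssential β) (f : A ⟶ B) : IsEssential ((coeffMap f n).hom β) := by
  obtain ⟨μ, rfl⟩ := h
  exact ⟨μ ≫ f, coeffMap_comp μ f n _⟩

lemma coeffMap_inv_hom {A B : Rep.{0} k (π × π)} (e : A ≅ B) (n : ℕ) (β : groupCohomology B n) :
    (Bredon.coeffMap e.hom n).hom ((Bredon.coeffMap e.inv n).hom β) = β := by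
  rw [← coeffMap_comp, e.inv_hom_id]
  exact congrArg (fun t => t.hom β) ((groupCohomology.functor k (π × π) n).map_id B)

end Bredon

end
theorem mainTheorem6 (π : Type) [Group π] (n : ℕ) :
    (∀ (M : Bredon.OModule π ℤ) (α : Bredon.cohomology M n),
      Bredon.IsEssential ((Bredon.phi M n).hom α)) ∧
    (Bredon.IsPrincipalGroup π →
      (∀ M : Bredon.OModule π ℤ, Bredon.IsPrincipalModule M →
        {β : groupCohomology (Bredon.principalComponent M) n | Bredon.IsEssential β} =
          Set.range (Bredon.phi M n).hom) ∧
      (∀ (A : Rep.{0} ℤ (π × π)) (β : groupCohomology A n),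
        Bredon.IsEssential β ↔
          ∃ (M : Bredon.OModule π ℤ) (e : Bredon.principalComponent M ≅ A)
            (α : Bredon.cohomology M n),
            (Bredon.coeffMap e.hom n).hom ((Bredon.phi M n).hom α) = β)) := by
  refine ⟨fun M α => Bredon.isEssential_phi α,
    fun _ => ⟨fun M hM => ?_, fun A β => ⟨fun h => ?_, ?_⟩⟩⟩
  · refine Set.Subset.antisymm (fun β hβ => Bredon.exists_phi_eq hM hβ) ?_
    rintro _ ⟨α, rfl⟩
    exact Bredon.isEssential_phi α
  -- The class is moved along `e.inv` to the principal component of `fixedPoints A`, lifted there,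
  -- and moved back.
  · let e := Bredon.principalComponentFixedPoints A
    obtain ⟨α, hα⟩ := Bredon.exists_phi_eq (Bredon.isPrincipalModule_fixedPoints A)
      (h.coeffMap e.inv)
    exact ⟨Bredon.fixedPoints A, e, α, by rw [hα, Bredon.coeffMap_inv_hom]⟩
  · rintro ⟨M, e, α, rfl⟩
    exact (Bredon.isEssential_phi α).coeffMap e.hom
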